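/- Let $E$ be a nonzero real Banach space with dual $E^*$, and let $S\colon E \rightrightarrows E^*$ be a multifunction with nonempty graph $G(S)=\{(s,s^*)\in E\times E^*: s^*\in S(s)\}$. Suppose that $S$ is closed (that is, $G(S)$ is norm-closed in $E\times E^*$) and monotone (that is, $\langle s-t,s^*-t^*\rangle\ge 0$ for all $(s,s^*),(t,t^*)\in G(S)$). Then the following conditions are equivalent: (a) $S$ is quasidense, that is, for all $(x,x^*)\in E\times E^*$, $$\inf_{(s,s^*)\in G(S)}\Big[\tfrac12\|s-x\|^2+\tfrac12\|s^*-x^*\|^2+\langle s-x,s^*-x^*\rangle\Big]\le 0.$$ (b) For every $w\in E$, every nonempty weak$^*$-compact convex subset $\widetilde W$ of $E^*$ and every $\eta>0$, there exists $(s,s^*)\in G(S)$ such that $$\tfrac12\|s-w\|^2+\tfrac12\,\mathrm{dist}(s^*,\widetilde W)^2+\max_{w^*\in\widetilde W}\langle s-w,s^*-w^*\rangle<\eta,$$ where $\mathrm{dist}(s^*,\widetilde W)=\inf_{w^*\in\widetilde W}\|s^*-w^*\|$. -/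

import Mathlib

namespace Multifunction

variable {E : Type*} [NormedAddCommGroup E] [NormedSpace ℝ E]

/-- The graph of a multifunction from `E` into its (norm) dual, as a subset of `E × E*`. -/
def graph (S : E → Set (StrongDual ℝ E)) : Set (E × StrongDual ℝ E) :=
  {p | p.2 ∈ S p.1}

/-- The multifunction is closed: its graph is closed for the norm topology of `E × E*`. -/
def IsClosedGraph (S : E → Set (StrongDual ℝ E)) : Prop :=
  IsClosed (graph S)

/-- The multifunction is monotone: `⟨x - y, x* - y*⟩ ≥ 0` for all `(x, x*)` and `(y, y*)` in the
graph. -/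
def IsMonotone (S : E → Set (StrongDual ℝ E)) : Prop :=
  ∀ p ∈ graph S, ∀ q ∈ graph S, 0 ≤ (p.2 - q.2) (p.1 - q.1)

/-- Quasidensity. The infimum is taken in the extended reals, so that it is the true infimum. -/
def IsQuasidense (S : E → Set (StrongDual ℝ E)) : Prop :=
  ∀ (x : E) (x' : StrongDual ℝ E),
    (⨅ p ∈ graph S, (((1 / 2 : ℝ) * ‖p.1 - x‖ ^ 2 + (1 / 2 : ℝ) * ‖p.2 - x'‖ ^ 2
      + (p.2 - x') (p.1 - x) : ℝ) : EReal)) ≤ 0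

/-- A subset of the dual `E*` is compact for the weak* topology `w(E*, E)`. -/
def IsWeakStarCompact (W : Set (StrongDual ℝ E)) : Prop :=
  IsCompact (StrongDual.toWeakDual '' W)

end Multifunction

/-!
Condition (b) for singletons `W` is quasidensity. For the converse, translate to `w = 0` and put
`k(x, x*) = ½‖x‖² + σ_W(-x) + ½ dist(x*, W)²`, with `σ_W` the support function of `W`; a point of
the graph is wanted at which `k` plus the pairing is small. The Young inequality gives
`k(x, x*) ≥ -⟨x, x*⟩`, and weak* separation of `W` from balls gives the dual inequality
`k⋆(-y, -z) ≥ -⟨y, z⟩` on `E* × E**`.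

Were the Fitzpatrick function `φ_S` to stay above `ε - k`, an affine function `⟨·, y⟩ + ⟨·, z⟩ + u`
would lie between the two. On the graph, where `φ_S` is the pairing, this contradicts the dual
inequality, since a quasidense `S` satisfies `inf ⟨s - z, s* - y⟩ ≤ 0` for all `y ∈ E*`, `z ∈ E**`.
Hence `φ_S + k` takes arbitrarily small values. At a point `b` where it is small, both
`φ_S - ⟨·, ·⟩` and `k + ⟨·, ·⟩`, which are nonnegative, are small. Applied at `b`, quasidensity then
gives a graph point close to `b`. Coercivity of `k` keeps these `b` in a bounded set, on which `k`
and the pairing are uniformly continuous, so `k + ⟨·, ·⟩` is small at the graph point too.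
-/

open Bornology Metric Set

theorem exists_affine_between_of_concaveOn {V : Type*} [AddCommGroup V] [Module ℝ V]
    [TopologicalSpace V] [IsTopologicalAddGroup V] [ContinuousSMul ℝ V] {g : V → ℝ}
    (hg : ConcaveOn ℝ univ g) (hgc : Continuous g) {C : Set (V × ℝ)} (hC : Convex ℝ C)
    (hne : C.Nonempty) (hgC : ∀ c ∈ C, g c.1 ≤ c.2) :
    ∃ (f : StrongDual ℝ V) (u : ℝ), (∀ v, g v ≤ f v + u) ∧ ∀ c ∈ C, f c.1 + u ≤ c.2 := by
  have hconv : Convex ℝ {p : V × ℝ | p.2 < g p.1} := by simpa using hg.convex_strict_hypograph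
  have hopen : IsOpen {p : V × ℝ | p.2 < g p.1} :=
    isOpen_lt continuous_snd (hgc.comp continuous_fst)
  obtain ⟨F, u, hFg, hFC⟩ := geometric_hahn_banach_open hconv hopen hC
    (disjoint_left.2 fun p hp hpC ↦ (hgC p hpC).not_gt hp)
  set a : ℝ := F (0, 1)
  have hF (p : V × ℝ) : F p = F (p.1, 0) + p.2 * a := by
    rw [← smul_eq_mul, ← map_smul, ← map_add]
    simp
  have ha : 0 < a := by
    obtain ⟨c, hc⟩ := hne
    have hupper := hFC c hc
    have hlower := hFg (c.1, g c.1 - 1) (sub_one_lt (g c.1))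
    rw [hF] at hupper hlower
    have hgap : 0 < (c.2 - (g c.1 - 1)) * a := by linarith
    exact (pos_iff_pos_of_mul_pos hgap).1 (by linarith [hgC c hc])
  have hvalue (v : V) :
      (-(a⁻¹ • F.comp (ContinuousLinearMap.inl ℝ V ℝ))) v + u / a = (u - F (v, 0)) / a := by
    simp only [neg_apply, smul_apply, ContinuousLinearMap.comp_apply,
      ContinuousLinearMap.inl_apply, smul_eq_mul]
    ring
  refine ⟨-(a⁻¹ • F.comp (ContinuousLinearMap.inl ℝ V ℝ)), u / a, fun v ↦ ?_, fun c hc ↦ ?_⟩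
  · rw [hvalue]
    refine le_of_forall_lt_imp_le_of_dense fun t ht ↦ (le_div_iff₀ ha).2 ?_
    have hbelow := hFg (v, t) ht
    rw [hF] at hbelow
    linarith
  · rw [hvalue, div_le_iff₀ ha]
    have habove := hFC c hc
    rw [hF] at habove
    linarith

section Normed

variable {V : Type*} [NormedAddCommGroup V]

theorem norm_le_infDist_add {s : Set V} (hne : s.Nonempty) {M : ℝ} (hM : ∀ w ∈ s, ‖w‖ ≤ M)
    (x : V) : ‖x‖ ≤ infDist x s + M := by
  refine sub_le_iff_le_add.1 ((le_infDist hne).2 fun w hw ↦ ?_)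
  rw [dist_eq_norm]
  linarith [hM w hw, norm_le_norm_sub_add x w]

theorem infDist_le_norm_add {s : Set V} (hne : s.Nonempty) {M : ℝ} (hM : ∀ w ∈ s, ‖w‖ ≤ M)
    (x : V) : infDist x s ≤ ‖x‖ + M := by
  obtain ⟨w, hw⟩ := hne
  calc infDist x s ≤ ‖x - w‖ := dist_eq_norm x w ▸ infDist_le_dist_of_mem hw
    _ ≤ ‖x‖ + M := (norm_sub_le x w).trans (by gcongr; exact hM w hw)

variable [NormedSpace ℝ V]

theorem convexOn_infDist {s : Set V} (hs : Convex ℝ s) (hne : s.Nonempty) :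
    ConvexOn ℝ univ fun x ↦ infDist x s := by
  refine ⟨convex_univ, fun x _ y _ a b ha hb hab ↦ le_of_forall_pos_le_add fun ε hε ↦ ?_⟩
  obtain ⟨u, hu, hxu⟩ := (infDist_lt_iff hne).1 (lt_add_of_pos_right (infDist x s) hε)
  obtain ⟨v, hv, hyv⟩ := (infDist_lt_iff hne).1 (lt_add_of_pos_right (infDist y s) hε)
  calc infDist (a • x + b • y) s
      ≤ dist (a • x + b • y) (a • u + b • v) := infDist_le_dist_of_mem (hs hu hv ha hb hab)
    _ ≤ a * dist x u + b * dist y v := by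
        refine (dist_add_add_le _ _ _ _).trans_eq ?_
        rw [dist_smul₀, dist_smul₀, Real.norm_of_nonneg ha, Real.norm_of_nonneg hb]
    _ ≤ a * (infDist x s + ε) + b * (infDist y s + ε) := by gcongr
    _ = a • infDist x s + b • infDist y s + ε := by
        simp only [smul_eq_mul]
        linear_combination ε * hab

theorem neg_apply_le_half_sq_add_half_sq (f : StrongDual ℝ V) (x : V) :
    -(f x) ≤ 1 / 2 * ‖f‖ ^ 2 + 1 / 2 * ‖x‖ ^ 2 := by
  linarith [neg_le_of_abs_le (f.le_opNorm x), sq_nonneg (‖f‖ - ‖x‖)]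

theorem isBounded_setOf_add_apply_le_of_quadratic_growth {k : V → ℝ} {α β : ℝ} (hα : 0 < α)
    (hk : ∀ v, α * ‖v‖ ^ 2 - β ≤ k v) (f : StrongDual ℝ V) (r : ℝ) :
    IsBounded {v | k v + f v ≤ r} := by
  refine isBounded_iff_forall_norm_le.2 ⟨(‖f‖ + |r + β| + 1) / α + 1, fun v hv ↦ ?_⟩
  by_contra! hlt
  have hmul : ‖f‖ + |r + β| + 1 < α * ‖v‖ := by
    rw [mul_comm, ← div_lt_iff₀ hα]
    linarith
  have hone : 1 ≤ ‖v‖ := by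
    have : 0 ≤ (‖f‖ + |r + β| + 1) / α := by positivity
    linarith
  have hv' : k v + f v ≤ r := hv
  nlinarith [hk v, neg_le_of_abs_le (f.le_opNorm v), le_abs_self (r + β), abs_nonneg (r + β)]

theorem uniformContinuousOn_ball_of_convexOn {k : V → ℝ} (hk : ConvexOn ℝ univ k)
    (hbdd : ∀ R, IsBounded (k '' ball 0 R)) (R : ℝ) : UniformContinuousOn k (ball 0 R) := by
  obtain ⟨K, hK⟩ := (hk.subset (subset_univ _) (convex_ball 0 (R + 1))
    ).exists_lipschitzOnWith_of_isBounded (lt_add_one R) (hbdd (R + 1))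
  exact hK.uniformContinuousOn

theorem uniformContinuousOn_pairing_ball (R : ℝ) :
    UniformContinuousOn (fun b : V × StrongDual ℝ V ↦ b.2 b.1) (ball 0 R) := by
  refine (LipschitzOnWith.of_dist_le' (K := 2 * R) fun b hb c hc ↦ ?_).uniformContinuousOn
  rw [mem_ball_zero_iff] at hb hc
  have hbR : ‖b.1‖ ≤ R ∧ ‖c.2‖ ≤ R := ⟨(norm_fst_le b).trans hb.le, (norm_snd_le c).trans hc.le⟩
  calc dist (b.2 b.1) (c.2 c.1) = ‖(b - c).2 b.1 + c.2 (b - c).1‖ := by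
        rw [Real.dist_eq, Real.norm_eq_abs]
        simp
    _ ≤ ‖(b - c).2‖ * ‖b.1‖ + ‖c.2‖ * ‖(b - c).1‖ :=
        (norm_add_le _ _).trans (add_le_add (ContinuousLinearMap.le_opNorm _ _)
          (ContinuousLinearMap.le_opNorm _ _))
    _ ≤ dist b c * R + R * dist b c := by
        rw [dist_eq_norm]
        have hR : 0 ≤ R := (norm_nonneg _).trans hbR.1
        gcongr
        exacts [norm_snd_le (b - c), hbR.1, hbR.2, norm_fst_le (b - c)]
    _ = 2 * R * dist b c := by ring

end Normed

namespace Multifunction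

variable {E : Type*} [NormedAddCommGroup E] [NormedSpace ℝ E]

/-- The support function `σ_W(x) = sup_{w ∈ W} ⟨x, w⟩` of a set `W` of functionals. It has its usual
meaning for nonempty bounded `W`, and the junk value `0` where the supremum does not exist. -/
noncomputable def supportFunction (W : Set (StrongDual ℝ E)) (x : E) : ℝ :=
  sSup ((fun w ↦ w x) '' W)

variable {W : Set (StrongDual ℝ E)} {M : ℝ}

theorem le_supportFunction (hM : ∀ w ∈ W, ‖w‖ ≤ M) {w : StrongDual ℝ E} (hw : w ∈ W) (x : E) :
    w x ≤ supportFunction W x := by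
  refine le_csSup ⟨M * ‖x‖, ?_⟩ (mem_image_of_mem _ hw)
  rintro _ ⟨v, hv, rfl⟩
  exact (le_abs_self _).trans (v.le_of_opNorm_le (hM v hv) x)

theorem abs_supportFunction_le (hne : W.Nonempty) (hM : ∀ w ∈ W, ‖w‖ ≤ M) (x : E) :
    |supportFunction W x| ≤ M * ‖x‖ := by
  refine abs_le.2 ⟨?_, csSup_le (hne.image _) ?_⟩
  · obtain ⟨w, hw⟩ := hne
    exact (abs_le.1 (w.le_of_opNorm_le (hM w hw) x)).1.trans (le_supportFunction hM hw x)
  · rintro _ ⟨w, hw, rfl⟩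
    exact (abs_le.1 (w.le_of_opNorm_le (hM w hw) x)).2

theorem convexOn_supportFunction (hne : W.Nonempty) (hM : ∀ w ∈ W, ‖w‖ ≤ M) :
    ConvexOn ℝ univ (supportFunction W) := by
  refine ⟨convex_univ, fun x _ y _ a b ha hb _ ↦ csSup_le (hne.image _) ?_⟩
  rintro _ ⟨w, hw, rfl⟩
  simp only [map_add, map_smul, smul_eq_mul]
  gcongr <;> exact le_supportFunction hM hw _

theorem IsWeakStarCompact.exists_norm_le [CompleteSpace E] (hW : IsWeakStarCompact W) :
    ∃ M, ∀ w ∈ W, ‖w‖ ≤ M := by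
  have hbdd := WeakDual.isBounded_iff_isVonNBounded.2 (hW.isVonNBounded ℝ)
  rw [← WeakDual.isBounded_toWeakDual_preimage_iff_isBounded,
    preimage_image_eq _ StrongDual.toWeakDual.injective] at hbdd
  exact hbdd.exists_norm_le

theorem IsWeakStarCompact.isGreatest_supportFunction (hW : IsWeakStarCompact W)
    (hne : W.Nonempty) (x : E) : IsGreatest ((fun w ↦ w x) '' W) (supportFunction W x) := by
  refine IsCompact.isGreatest_sSup ?_ (hne.image _)
  have hcompact := hW.image (WeakDual.eval_continuous x)
  rwa [image_image] at hcompact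

theorem IsWeakStarCompact.isGreatest_sub_apply (hW : IsWeakStarCompact W) (hne : W.Nonempty)
    (y : StrongDual ℝ E) (x : E) :
    IsGreatest ((fun w ↦ (y - w) x) '' W) (y x + supportFunction W (-x)) := by
  have hmono : Monotone (y x + ·) := fun _ _ h ↦ add_le_add_right h _
  simpa [image_image, ← sub_eq_add_neg] using
    hmono.map_isGreatest (hW.isGreatest_supportFunction hne (-x))

/-- Hahn–Banach separation for the weak* topology: the weak* compact ball `closedBall y r` misses
the weak* closed convex set `W`, and weak* continuous functionals are evaluations at points of `E`.
-/
theorem IsWeakStarCompact.exists_forall_sub_apply_lt (hW : IsWeakStarCompact W)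
    (hconv : Convex ℝ W) (y : StrongDual ℝ E) {r : ℝ} (hr : 0 ≤ r) (hlt : r < infDist y W) :
    ∃ x : E, ∀ w ∈ W, (y - w) x < -(r * ‖x‖) := by
  have hballconv : Convex ℝ (WeakDual.toStrongDual (𝕜 := ℝ) (E := E) ⁻¹' closedBall y r) :=
    (convex_closedBall y r).linear_preimage WeakDual.toStrongDual.toLinearMap
  have hWconv : Convex ℝ (StrongDual.toWeakDual '' W) :=
    hconv.linear_image StrongDual.toWeakDual.toLinearMap
  have hdisj : Disjoint (WeakDual.toStrongDual (𝕜 := ℝ) (E := E) ⁻¹' closedBall y r)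
      (StrongDual.toWeakDual '' W) := by
    rw [disjoint_left]
    rintro _ hball ⟨w, hw, rfl⟩
    exact hlt.not_ge ((infDist_le_dist_of_mem hw).trans (mem_closedBall'.1 hball))
  have : LocallyConvexSpace ℝ (WeakDual ℝ E) :=
    inferInstanceAs (LocallyConvexSpace ℝ (WeakBilin (topDualPairing ℝ E)))
  obtain ⟨F, u, v, hFball, huv, hFW⟩ := geometric_hahn_banach_compact_closed hballconv
    (WeakDual.isCompact_closedBall (𝕜 := ℝ) y r) hWconv hW.isClosed hdisj
  obtain ⟨x, hx⟩ := LinearMap.dualEmbedding_surjective (topDualPairing ℝ E) F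
  have hFx (f : StrongDual ℝ E) : F (StrongDual.toWeakDual f) = f x := by rw [← hx]; rfl
  refine ⟨x, fun w hw ↦ ?_⟩
  obtain ⟨g, hg, hgx⟩ := exists_dual_vector'' ℝ x
  have hmem : y + r • g ∈ closedBall y r := by
    rw [mem_closedBall, dist_self_add_left, norm_smul, Real.norm_of_nonneg hr]
    exact mul_le_of_le_one_right hr hg
  have hball : y x + r * ‖x‖ < u := by
    simpa [hgx, hFx] using hFball (StrongDual.toWeakDual (y + r • g)) hmem
  have hWx : v < w x := hFx w ▸ hFW _ (mem_image_of_mem _ hw)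
  rw [sub_apply]
  linarith

theorem IsWeakStarCompact.exists_forall_half_sq_add_le (hW : IsWeakStarCompact W)
    (hne : W.Nonempty) (hconv : Convex ℝ W) (y : StrongDual ℝ E) {r : ℝ} (hr : 0 ≤ r)
    (hlt : r < infDist y W) :
    ∃ x : E, ∀ w ∈ W, 1 / 2 * ‖x‖ ^ 2 + (y - w) x ≤ -(1 / 2 * r ^ 2) := by
  obtain ⟨x, hx⟩ := hW.exists_forall_sub_apply_lt hconv y hr hlt
  have hnorm : 0 < ‖x‖ := by
    obtain ⟨w, hw⟩ := hne
    refine norm_pos_iff.2 fun hzero ↦ ?_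
    simpa [hzero] using hx w hw
  refine ⟨(r / ‖x‖) • x, fun w hw ↦ ?_⟩
  calc 1 / 2 * ‖(r / ‖x‖) • x‖ ^ 2 + (y - w) ((r / ‖x‖) • x)
      = 1 / 2 * r ^ 2 + r / ‖x‖ * (y - w) x := by
        rw [norm_smul, Real.norm_of_nonneg (by positivity), div_mul_cancel₀ _ hnorm.ne', map_smul,
          smul_eq_mul]
    _ ≤ 1 / 2 * r ^ 2 + r / ‖x‖ * -(r * ‖x‖) := by gcongr; exact (hx w hw).le
    _ = -(1 / 2 * r ^ 2) := by field_simp; ring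

theorem IsWeakStarCompact.exists_forall_half_sq_add_half_sq_infDist_le
    (hW : IsWeakStarCompact W) (hne : W.Nonempty) (hconv : Convex ℝ W) (y : StrongDual ℝ E)
    {ε : ℝ} (hε : 0 < ε) :
    ∃ x : E, ∀ w ∈ W, 1 / 2 * ‖x‖ ^ 2 + (y - w) x + 1 / 2 * infDist y W ^ 2 ≤ ε := by
  rcases (infDist_nonneg (x := y) (s := W)).eq_or_lt with hzero | hpos
  · exact ⟨0, fun w _ ↦ by simpa [← hzero] using hε.le⟩
  · set r := √(infDist y W ^ 2 - 2 * ε)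
    have hr : infDist y W ^ 2 - 2 * ε ≤ r ^ 2 := (Real.sqrt_le_iff.1 le_rfl).2
    have hlt : r < infDist y W := (Real.sqrt_lt' hpos).2 (by linarith)
    obtain ⟨x, hx⟩ := hW.exists_forall_half_sq_add_le hne hconv y (Real.sqrt_nonneg _) hlt
    exact ⟨x, fun w hw ↦ by linarith [hx w hw]⟩

theorem exists_half_sq_add_apply_add_half_sq_le (f : StrongDual ℝ E) {ε : ℝ} (hε : 0 < ε) :
    ∃ x : E, 1 / 2 * ‖x‖ ^ 2 + f x + 1 / 2 * ‖f‖ ^ 2 ≤ ε := by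
  have hcompact : IsWeakStarCompact ({0} : Set (StrongDual ℝ E)) := by simp [IsWeakStarCompact]
  obtain ⟨x, hx⟩ := hcompact.exists_forall_half_sq_add_half_sq_infDist_le (singleton_nonempty 0)
    (convex_singleton 0) f hε
  exact ⟨x, by simpa using hx 0 rfl⟩

/-- The Fitzpatrick function `φ_S(x, x*) = sup_{(s, s*) ∈ G(S)} ⟨x, s*⟩ + ⟨s, x*⟩ - ⟨s, s*⟩`,
encoded by its epigraph because it may take the value `∞`. -/
def fitzpatrickEpigraph (S : E → Set (StrongDual ℝ E)) : Set ((E × StrongDual ℝ E) × ℝ) :=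
  {c | ∀ p ∈ graph S, p.2 c.1.1 + c.1.2 p.1 - p.2 p.1 ≤ c.2}

variable {S : E → Set (StrongDual ℝ E)}

theorem convex_fitzpatrickEpigraph : Convex ℝ (fitzpatrickEpigraph S) := by
  intro c hc d hd a b ha hb hab p hp
  have hcp := mul_le_mul_of_nonneg_left (hc p hp) ha
  have hdp := mul_le_mul_of_nonneg_left (hd p hp) hb
  simp only [Prod.fst_add, Prod.snd_add, Prod.smul_fst, Prod.smul_snd, map_add, map_smul,
    add_apply, smul_apply, smul_eq_mul]
  linear_combination hcp + hdp + (p.2 p.1) * hab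

theorem IsMonotone.mem_fitzpatrickEpigraph (hmono : IsMonotone S) {p : E × StrongDual ℝ E}
    (hp : p ∈ graph S) : (p, p.2 p.1) ∈ fitzpatrickEpigraph S := by
  intro q hq
  have hpq := hmono p hp q hq
  simp only [map_sub, sub_apply] at hpq
  linarith

theorem isQuasidense_iff : IsQuasidense S ↔ ∀ (x : E) (x' : StrongDual ℝ E) (ε : ℝ), 0 < ε →
    ∃ p ∈ graph S,
      1 / 2 * ‖p.1 - x‖ ^ 2 + 1 / 2 * ‖p.2 - x'‖ ^ 2 + (p.2 - x') (p.1 - x) < ε := by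
  refine forall₂_congr fun x x' ↦ ⟨fun hinf ε hε ↦ ?_, fun happrox ↦ ?_⟩
  · have hlt := hinf.trans_lt (EReal.coe_pos.2 hε)
    simp only [iInf_lt_iff, EReal.coe_lt_coe_iff, exists_prop] at hlt
    exact hlt
  · refine EReal.le_of_forall_lt_iff_le.1 fun ε hε ↦ ?_
    obtain ⟨p, hp, hlt⟩ := happrox ε (EReal.coe_pos.1 hε)
    exact (iInf₂_le p hp).trans (EReal.coe_le_coe_iff.2 hlt.le)

theorem IsQuasidense.nonempty_graph (hS : IsQuasidense S) : (graph S).Nonempty := by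
  obtain ⟨p, hp, -⟩ := isQuasidense_iff.1 hS 0 0 1 one_pos
  exact ⟨p, hp⟩

theorem IsQuasidense.comp_add_right (hS : IsQuasidense S) (w : E) :
    IsQuasidense fun x ↦ S (x + w) := by
  refine isQuasidense_iff.2 fun x x' ε hε ↦ ?_
  obtain ⟨⟨s, s'⟩, hs, hlt⟩ := isQuasidense_iff.1 hS (x + w) x' ε hε
  exact ⟨(s - w, s'), by simpa [graph] using hs, by simpa only [sub_sub, add_comm w x] using hlt⟩

theorem IsMonotone.comp_add_right (hS : IsMonotone S) (w : E) :
    IsMonotone fun x ↦ S (x + w) :=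
  fun p hp q hq ↦ by simpa using hS (p.1 + w, p.2) hp (q.1 + w, q.2) hq

theorem IsQuasidense.exists_half_sq_add_half_sq_lt (hS : IsQuasidense S)
    {c : (E × StrongDual ℝ E) × ℝ} (hc : c ∈ fitzpatrickEpigraph S) {ε : ℝ} (hε : 0 < ε) :
    ∃ p ∈ graph S, 1 / 2 * ‖p.1 - c.1.1‖ ^ 2 + 1 / 2 * ‖p.2 - c.1.2‖ ^ 2
      < c.2 - c.1.2 c.1.1 + ε := by
  obtain ⟨p, hp, hlt⟩ := isQuasidense_iff.1 hS c.1.1 c.1.2 ε hε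
  refine ⟨p, hp, ?_⟩
  have hpc := hc p hp
  simp only [map_sub, sub_apply] at hlt
  linarith

theorem IsQuasidense.pairing_le_of_mem_fitzpatrickEpigraph (hS : IsQuasidense S)
    {c : (E × StrongDual ℝ E) × ℝ} (hc : c ∈ fitzpatrickEpigraph S) : c.1.2 c.1.1 ≤ c.2 := by
  refine le_of_forall_pos_le_add fun ε hε ↦ ?_
  obtain ⟨p, -, hlt⟩ := hS.exists_half_sq_add_half_sq_lt hc hε
  linarith [sq_nonneg ‖p.1 - c.1.1‖, sq_nonneg ‖p.2 - c.1.2‖]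

/-- Quasidense multifunctions are of negative infimum type (NI). -/
theorem IsQuasidense.exists_lt_add_sub (hS : IsQuasidense S) (y : StrongDual ℝ E)
    (z : StrongDual ℝ (StrongDual ℝ E)) {ε : ℝ} (hε : 0 < ε) :
    ∃ p ∈ graph S, z y - ε < y p.1 + z p.2 - p.2 p.1 := by
  obtain ⟨v, hv⟩ := exists_half_sq_add_apply_add_half_sq_le z (half_pos hε)
  obtain ⟨p, hp, hlt⟩ := isQuasidense_iff.1 hS 0 (y - v) (ε / 2) (half_pos hε)
  refine ⟨p, hp, ?_⟩
  set d := p.2 - (y - v) with hd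
  have hp2 : p.2 = y - v + d := by rw [hd]; abel
  have hzd := neg_apply_le_half_sq_add_half_sq z d
  have hvs := neg_apply_le_half_sq_add_half_sq v p.1
  simp only [hp2, map_add, map_sub, add_apply, sub_apply, sub_zero] at hlt ⊢
  linarith

/-- The inequality `k⋆(-y, -z) ≥ -⟨y, z⟩` on `E* × E**` for the convex conjugate `k⋆` of `k`, which
is the dual form of `k(x, x*) ≥ -⟨x, x*⟩`. It is written as
`inf_b (k b + ⟨b.1, y⟩ + ⟨b.2, z⟩) ≤ ⟨y, z⟩`, so that infinite values of `k⋆` cause no trouble. -/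
def ConjugateDominatesNegPairing (k : E × StrongDual ℝ E → ℝ) : Prop :=
  ∀ (y : StrongDual ℝ E) (z : StrongDual ℝ (StrongDual ℝ E)) (ε : ℝ), 0 < ε →
    ∃ b : E × StrongDual ℝ E, k b + y b.1 + z b.2 < z y + ε

variable {k : E × StrongDual ℝ E → ℝ}

theorem IsQuasidense.exists_mem_fitzpatrickEpigraph_add_lt (hS : IsQuasidense S)
    (hmono : IsMonotone S) (hk : ConvexOn ℝ univ k) (hkc : Continuous k)
    (hconj : ConjugateDominatesNegPairing k) {ε : ℝ} (hε : 0 < ε) :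
    ∃ c ∈ fitzpatrickEpigraph S, c.2 + k c.1 < ε := by
  by_contra! hge
  obtain ⟨p₀, hp₀⟩ := hS.nonempty_graph
  obtain ⟨f, u, hfk, hfS⟩ := exists_affine_between_of_concaveOn (g := fun b ↦ ε - k b)
    ((concaveOn_const ε convex_univ).sub hk) (by fun_prop) convex_fitzpatrickEpigraph
    ⟨_, hmono.mem_fitzpatrickEpigraph hp₀⟩ fun c hc ↦ sub_le_iff_le_add.2 (hge c hc)
  set y := f.comp (ContinuousLinearMap.inl ℝ E (StrongDual ℝ E))
  set z := f.comp (ContinuousLinearMap.inr ℝ E (StrongDual ℝ E))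
  have hf (b : E × StrongDual ℝ E) : f b = y b.1 + z b.2 := by simp [y, z, ← map_add]
  obtain ⟨p, hp, hNI⟩ := hS.exists_lt_add_sub y z (half_pos hε)
  obtain ⟨b, hb⟩ := hconj y z (ε / 2) (half_pos hε)
  have hfp : y p.1 + z p.2 + u ≤ p.2 p.1 := hf p ▸ hfS _ (hmono.mem_fitzpatrickEpigraph hp)
  have hfb : ε - k b ≤ y b.1 + z b.2 + u := hf b ▸ hfk b
  linarith

theorem isBounded_setOf_mem_fitzpatrickEpigraph_add_le (hne : (graph S).Nonempty)
    (hcoercive : ∀ (f : StrongDual ℝ (E × StrongDual ℝ E)) (r : ℝ), IsBounded {b | k b + f b ≤ r})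
    (r : ℝ) : IsBounded {b | ∃ t, (b, t) ∈ fitzpatrickEpigraph S ∧ t + k b ≤ r} := by
  obtain ⟨p, hp⟩ := hne
  refine (hcoercive (p.2.coprod (NormedSpace.inclusionInDoubleDual ℝ E p.1))
    (r + p.2 p.1)).subset ?_
  rintro b ⟨t, hbt, hle⟩
  have hbp := hbt p hp
  simp only [mem_ofPred_eq, ContinuousLinearMap.coprod_apply, NormedSpace.dual_def]
  linarith

theorem IsQuasidense.exists_mem_graph_dist_lt (hS : IsQuasidense S)
    (hpair : ∀ b : E × StrongDual ℝ E, 0 ≤ k b + b.2 b.1) {c : (E × StrongDual ℝ E) × ℝ}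
    (hc : c ∈ fitzpatrickEpigraph S) {δ : ℝ} (hδ : 0 < δ) (hlt : c.2 + k c.1 < δ ^ 2 / 4) :
    ∃ p ∈ graph S, dist p c.1 < δ := by
  obtain ⟨p, hp, hpc⟩ := hS.exists_half_sq_add_half_sq_lt hc (show 0 < δ ^ 2 / 4 by positivity)
  have hsq : ‖p.1 - c.1.1‖ ^ 2 + ‖p.2 - c.1.2‖ ^ 2 < δ ^ 2 := by linarith [hpair c.1]
  refine ⟨p, hp, ?_⟩
  rw [Prod.dist_eq, dist_eq_norm, dist_eq_norm]
  exact max_lt (lt_of_pow_lt_pow_left₀ 2 hδ.le (by linarith [sq_nonneg ‖p.2 - c.1.2‖]))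
    (lt_of_pow_lt_pow_left₀ 2 hδ.le (by linarith [sq_nonneg ‖p.1 - c.1.1‖]))

theorem IsQuasidense.exists_bounded_forall_exists_dist_lt (hS : IsQuasidense S)
    (hmono : IsMonotone S) (hk : ConvexOn ℝ univ k) (hkc : Continuous k)
    (hcoercive : ∀ (f : StrongDual ℝ (E × StrongDual ℝ E)) (r : ℝ), IsBounded {b | k b + f b ≤ r})
    (hpair : ∀ b : E × StrongDual ℝ E, 0 ≤ k b + b.2 b.1)
    (hconj : ConjugateDominatesNegPairing k) :
    ∃ R, ∀ δ > 0, ∃ b, ‖b‖ ≤ R ∧ k b + b.2 b.1 < δ ∧ ∃ p ∈ graph S, dist p b < δ := by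
  obtain ⟨R, hR⟩ := (isBounded_setOf_mem_fitzpatrickEpigraph_add_le hS.nonempty_graph hcoercive
    1).exists_norm_le
  refine ⟨R, fun δ hδ ↦ ?_⟩
  obtain ⟨c, hc, hlt⟩ := hS.exists_mem_fitzpatrickEpigraph_add_lt hmono hk hkc hconj
    (show 0 < min 1 (min δ (δ ^ 2 / 4)) by positivity)
  obtain ⟨hone, hltδ, hsq⟩ : c.2 + k c.1 < 1 ∧ c.2 + k c.1 < δ ∧ c.2 + k c.1 < δ ^ 2 / 4 := by
    simpa only [lt_min_iff] using hlt
  exact ⟨c.1, hR c.1 ⟨c.2, hc, hone.le⟩, by linarith [hS.pairing_le_of_mem_fitzpatrickEpigraph hc],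
    hS.exists_mem_graph_dist_lt hpair hc hδ hsq⟩

/-- Boundedness of the approximate minimizers `b` makes up for `k` and the pairing being uniformly
continuous on bounded sets only. -/
theorem IsQuasidense.exists_mem_graph_add_pairing_lt (hS : IsQuasidense S) (hmono : IsMonotone S)
    (hk : ConvexOn ℝ univ k) (hbdd : ∀ R, IsBounded (k '' ball 0 R))
    (hcoercive : ∀ (f : StrongDual ℝ (E × StrongDual ℝ E)) (r : ℝ), IsBounded {b | k b + f b ≤ r})
    (hpair : ∀ b : E × StrongDual ℝ E, 0 ≤ k b + b.2 b.1)
    (hconj : ConjugateDominatesNegPairing k) {η : ℝ} (hη : 0 < η) :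
    ∃ p ∈ graph S, k p + p.2 p.1 < η := by
  have hunif (R : ℝ) := uniformContinuousOn_ball_of_convexOn hk hbdd R
  have hkc : Continuous k := continuous_iff_continuousAt.2 fun b ↦
    (hunif (‖b‖ + 1)).continuousOn.continuousAt (isOpen_ball.mem_nhds (by simp))
  obtain ⟨R, hR⟩ :=
    hS.exists_bounded_forall_exists_dist_lt hmono hk hkc hcoercive hpair hconj
  obtain ⟨δ₁, hδ₁, hkclose⟩ :=
    Metric.uniformContinuousOn_iff.1 (hunif (R + 1)) (η / 3) (by positivity)
  obtain ⟨δ₂, hδ₂, hpclose⟩ :=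
    Metric.uniformContinuousOn_iff.1 (uniformContinuousOn_pairing_ball (V := E) (R + 1)) (η / 3)
      (by positivity)
  obtain ⟨b, hbR, hb, p, hp, hpb⟩ :=
    hR (min (min 1 (η / 3)) (min δ₁ δ₂)) (by positivity)
  simp only [lt_min_iff] at hb hpb
  have hbball : b ∈ ball 0 (R + 1) := mem_ball_zero_iff.2 (by linarith)
  have hpball : p ∈ ball 0 (R + 1) := mem_ball_zero_iff.2 <|
    calc ‖p‖ ≤ dist p b + ‖b‖ := dist_eq_norm p b ▸ norm_le_norm_sub_add p b
      _ < R + 1 := by linarith [hpb.1.1]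
  have hkpb := (abs_lt.1 (hkclose p hpball b hbball hpb.2.1)).2
  have hqpb := (abs_lt.1 (hpclose p hpball b hbball hpb.2.2)).2
  exact ⟨p, hp, by linarith [hb.1.2]⟩

/-- The convex function `(x, x*) ↦ ½‖x‖² + σ_W(-x) + ½ dist(x*, W)²`. For weak* compact `W`, adding
the pairing `⟨x, x*⟩` to it gives the left-hand side of condition (b) at `w = 0`, because the
maximum there equals `⟨x, x*⟩ + σ_W(-x)`. -/
noncomputable def fuzzyPotential (W : Set (StrongDual ℝ E)) (b : E × StrongDual ℝ E) : ℝ :=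
  1 / 2 * ‖b.1‖ ^ 2 + supportFunction W (-b.1) + 1 / 2 * infDist b.2 W ^ 2

theorem convexOn_fuzzyPotential (hne : W.Nonempty) (hM : ∀ w ∈ W, ‖w‖ ≤ M)
    (hconv : Convex ℝ W) : ConvexOn ℝ univ (fuzzyPotential W) := by
  have hnorm : ConvexOn ℝ univ fun x : E ↦ (1 / 2 : ℝ) • ‖x‖ ^ 2 :=
    (convexOn_univ_norm.pow (fun _ _ ↦ norm_nonneg _) 2).smul (by norm_num)
  have hsupport : ConvexOn ℝ univ fun x ↦ supportFunction W (-x) :=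
    (convexOn_supportFunction hne hM).comp_linearMap (-LinearMap.id)
  have hdist : ConvexOn ℝ univ fun x ↦ (1 / 2 : ℝ) • infDist x W ^ 2 :=
    ((convexOn_infDist hconv hne).pow (fun _ _ ↦ infDist_nonneg) 2).smul (by norm_num)
  exact ((hnorm.add hsupport).comp_linearMap (LinearMap.fst ℝ E (StrongDual ℝ E))).add
    (hdist.comp_linearMap (LinearMap.snd ℝ E (StrongDual ℝ E)))

theorem quadratic_le_fuzzyPotential (hne : W.Nonempty) (hM : ∀ w ∈ W, ‖w‖ ≤ M)
    (b : E × StrongDual ℝ E) : 1 / 4 * ‖b‖ ^ 2 - 2 * M ^ 2 ≤ fuzzyPotential W b := by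
  have hsupport := (abs_le.1 (abs_supportFunction_le hne hM (-b.1))).1
  rw [norm_neg] at hsupport
  have hfst : 1 / 4 * ‖b.1‖ ^ 2 - M ^ 2 ≤ 1 / 2 * ‖b.1‖ ^ 2 + supportFunction W (-b.1) := by
    linarith [sq_nonneg (‖b.1‖ / 2 - M)]
  have hsnd : 1 / 4 * ‖b.2‖ ^ 2 - 1 / 2 * M ^ 2 ≤ 1 / 2 * infDist b.2 W ^ 2 := by
    have hle : ‖b.2‖ ^ 2 ≤ (infDist b.2 W + M) ^ 2 := by
      gcongr
      exact norm_le_infDist_add hne hM b.2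
    linarith [sq_nonneg (infDist b.2 W - M)]
  have hmax : ‖b‖ ^ 2 ≤ ‖b.1‖ ^ 2 + ‖b.2‖ ^ 2 := by
    rcases max_choice ‖b.1‖ ‖b.2‖ with h | h <;> rw [Prod.norm_def, h] <;>
      linarith [sq_nonneg ‖b.1‖, sq_nonneg ‖b.2‖]
  unfold fuzzyPotential
  linarith [sq_nonneg M]

theorem fuzzyPotential_le (hne : W.Nonempty) (hM : ∀ w ∈ W, ‖w‖ ≤ M) (b : E × StrongDual ℝ E) :
    fuzzyPotential W b ≤ (‖b‖ + M) ^ 2 := by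
  have hM0 : 0 ≤ M := hne.elim fun w hw ↦ (norm_nonneg w).trans (hM w hw)
  have hsupport : supportFunction W (-b.1) ≤ M * ‖b‖ := by
    refine (abs_le.1 (abs_supportFunction_le hne hM (-b.1))).2.trans ?_
    rw [norm_neg]
    gcongr
    exact norm_fst_le b
  have hfst : ‖b.1‖ ^ 2 ≤ ‖b‖ ^ 2 := by gcongr; exact norm_fst_le b
  have hdist : infDist b.2 W ^ 2 ≤ (‖b‖ + M) ^ 2 := by
    gcongr
    · exact infDist_nonneg
    · exact (infDist_le_norm_add hne hM b.2).trans (by gcongr; exact norm_snd_le b)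
  unfold fuzzyPotential
  linarith [sq_nonneg M]

theorem isBounded_image_fuzzyPotential_ball (hne : W.Nonempty) (hM : ∀ w ∈ W, ‖w‖ ≤ M) (R : ℝ) :
    IsBounded (fuzzyPotential W '' ball 0 R) := by
  refine (isBounded_Icc (-(2 * M ^ 2)) ((R + M) ^ 2)).subset ?_
  have hM0 : 0 ≤ M := hne.elim fun w hw ↦ (norm_nonneg w).trans (hM w hw)
  rintro _ ⟨b, hb, rfl⟩
  refine ⟨?_, (fuzzyPotential_le hne hM b).trans ?_⟩
  · linarith [quadratic_le_fuzzyPotential hne hM b, sq_nonneg ‖b‖]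
  · gcongr
    exact (mem_ball_zero_iff.1 hb).le

theorem fuzzyPotential_add_pairing_nonneg (hne : W.Nonempty) (hM : ∀ w ∈ W, ‖w‖ ≤ M)
    (b : E × StrongDual ℝ E) : 0 ≤ fuzzyPotential W b + b.2 b.1 := by
  set a := 1 / 2 * ‖b.1‖ ^ 2 + supportFunction W (-b.1) + b.2 b.1 with ha
  have hsqrt : √(-(2 * a)) ≤ infDist b.2 W := by
    refine (le_infDist hne).2 fun w hw ↦ Real.sqrt_le_iff.2 ⟨dist_nonneg, ?_⟩
    have hyoung := neg_apply_le_half_sq_add_half_sq (b.2 - w) b.1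
    have hsupport := le_supportFunction hM hw (-b.1)
    rw [sub_apply] at hyoung
    rw [map_neg] at hsupport
    rw [dist_eq_norm]
    linarith
  have hsq := (Real.sqrt_le_iff.1 hsqrt).2
  unfold fuzzyPotential
  linarith

theorem IsWeakStarCompact.conjugateDominatesNegPairing_fuzzyPotential (hW : IsWeakStarCompact W)
    (hne : W.Nonempty) (hconv : Convex ℝ W) :
    ConjugateDominatesNegPairing (fuzzyPotential W) := by
  intro y z ε hε
  obtain ⟨x, hx⟩ := hW.exists_forall_half_sq_add_half_sq_infDist_le hne hconv y (half_pos hε)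
  obtain ⟨w, hw, hmax⟩ := (hW.isGreatest_sub_apply hne y x).1
  refine ⟨(x, y), ?_⟩
  have hxw := hx w hw
  dsimp only [fuzzyPotential] at hmax ⊢
  linarith

theorem IsQuasidense.exists_isGreatest_lt [CompleteSpace E] (hS : IsQuasidense S)
    (hmono : IsMonotone S) (hne : W.Nonempty) (hW : IsWeakStarCompact W) (hconv : Convex ℝ W)
    (w : E) {η : ℝ} (hη : 0 < η) :
    ∃ s : E, ∃ s' : StrongDual ℝ E, (s, s') ∈ graph S ∧
      ∃ m : ℝ, IsGreatest ((fun w' : StrongDual ℝ E ↦ (s' - w') (s - w)) '' W) m ∧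
        1 / 2 * ‖s - w‖ ^ 2 + 1 / 2 * infDist s' W ^ 2 + m < η := by
  obtain ⟨M, hM⟩ := hW.exists_norm_le
  obtain ⟨⟨x, s'⟩, hx, hlt⟩ :=
    (hS.comp_add_right w).exists_mem_graph_add_pairing_lt (hmono.comp_add_right w)
      (convexOn_fuzzyPotential hne hM hconv) (isBounded_image_fuzzyPotential_ball hne hM)
      (isBounded_setOf_add_apply_le_of_quadratic_growth (by norm_num)
        (quadratic_le_fuzzyPotential hne hM))
      (fuzzyPotential_add_pairing_nonneg hne hM)
      (hW.conjugateDominatesNegPairing_fuzzyPotential hne hconv) hη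
  refine ⟨x + w, s', hx, s' x + supportFunction W (-x), ?_, ?_⟩
  · simpa only [add_sub_cancel_right] using hW.isGreatest_sub_apply hne s' x
  · rw [add_sub_cancel_right]
    dsimp only [fuzzyPotential] at hlt
    linarith

theorem isQuasidense_of_forall_singleton
    (h : ∀ (w : E) (w' : StrongDual ℝ E) (η : ℝ), 0 < η →
      ∃ s : E, ∃ s' : StrongDual ℝ E, (s, s') ∈ graph S ∧
        ∃ m : ℝ, IsGreatest ((fun v : StrongDual ℝ E ↦ (s' - v) (s - w)) '' {w'}) m ∧
          1 / 2 * ‖s - w‖ ^ 2 + 1 / 2 * infDist s' {w'} ^ 2 + m < η) :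
    IsQuasidense S := by
  refine isQuasidense_iff.2 fun x x' ε hε ↦ ?_
  obtain ⟨s, s', hs, m, hm, hlt⟩ := h x x' ε hε
  rw [image_singleton] at hm
  obtain rfl := hm.1
  exact ⟨(s, s'), hs, by simpa [dist_eq_norm] using hlt⟩

end Multifunction

theorem mainTheorem7_general {E : Type*} [NormedAddCommGroup E] [NormedSpace ℝ E]
    [CompleteSpace E] (S : E → Set (StrongDual ℝ E)) (hmono : Multifunction.IsMonotone S) :
    Multifunction.IsQuasidense S ↔
      ∀ (w : E) (W : Set (StrongDual ℝ E)), W.Nonempty → Multifunction.IsWeakStarCompact W →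
        Convex ℝ W → ∀ η : ℝ, 0 < η →
          ∃ s : E, ∃ s' : StrongDual ℝ E, (s, s') ∈ Multifunction.graph S ∧
            ∃ m : ℝ, IsGreatest ((fun w' : StrongDual ℝ E => (s' - w') (s - w)) '' W) m ∧
              (1 / 2 : ℝ) * ‖s - w‖ ^ 2 + (1 / 2 : ℝ) * Metric.infDist s' W ^ 2 + m < η := by
  refine ⟨fun hS w W hne hW hconv η hη ↦ hS.exists_isGreatest_lt hmono hne hW hconv w hη,
    fun h ↦ Multifunction.isQuasidense_of_forall_singleton fun w w' η hη ↦ ?_⟩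
  exact h w {w'} (singleton_nonempty w') (by simp [Multifunction.IsWeakStarCompact])
    (convex_singleton w') η hη

theorem mainTheorem7 {E : Type*} [NormedAddCommGroup E] [NormedSpace ℝ E] [CompleteSpace E]
    [Nontrivial E] (S : E → Set (StrongDual ℝ E))
    (hne : (Multifunction.graph S).Nonempty)
    (hclosed : Multifunction.IsClosedGraph S) (hmono : Multifunction.IsMonotone S) :
    Multifunction.IsQuasidense S ↔
      ∀ (w : E) (W : Set (StrongDual ℝ E)), W.Nonempty → Multifunction.IsWeakStarCompact W →
        Convex ℝ W → ∀ η : ℝ, 0 < η →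
          ∃ s : E, ∃ s' : StrongDual ℝ E, (s, s') ∈ Multifunction.graph S ∧
            ∃ m : ℝ, IsGreatest ((fun w' : StrongDual ℝ E => (s' - w') (s - w)) '' W) m ∧
              (1 / 2 : ℝ) * ‖s - w‖ ^ 2 + (1 / 2 : ℝ) * Metric.infDist s' W ^ 2 + m < η :=
  mainTheorem7_general S hmono
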